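/- Let $n,p,m$ be natural numbers, $\sigma>0$ and $B^*\in\mathbb{R}^{p\times m}$. Let $X\in\mathbb{R}^{n\times p}$ have i.i.d. $\mathcal N(0,1)$ entries and, independently of $X$, let $W\in\mathbb{R}^{n\times m}$ have i.i.d. $\mathcal N(0,\sigma^2)$ entries. For an unknown $n\times n$ permutation matrix $\Pi^*$ one observes $X$ and $Y=\Pi^*XB^*+W$. Let $\mathcal H$ be any subset of the set $\mathcal P_n$ of $n\times n$ permutation matrices, and suppose that $B^*$ is known. If $$\log\det\Bigl(I+\frac{B^{*\top}B^*}{\sigma^2}\Bigr)<\frac{\log|\mathcal H|-2}{n},$$ where both logarithms are taken to the same base $b\ge 2$ (for instance natural or binary logarithms), then $$\inf_{\widehat\Pi}\ \sup_{\Pi^*\in\mathcal H}\ \mathbb{P}\bigl(\widehat\Pi(X,Y)\neq\Pi^*\bigr)\ \ge\ \frac12 ,$$ where the probability is taken with respect to $X$ and $W$, and the infimum is over all estimators, that is, all measurable functions $\widehat\Pi$ of $(X,Y)$ with values in $\mathcal P_n$ (which may depend on $B^*$, $\sigma$ and $\mathcal H$). -/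

import Mathlib

open MeasureTheory ProbabilityTheory
open scoped ENNReal NNReal

noncomputable section

/-- The product (that is, Borel) σ-algebra on real matrices. -/
instance matrixMeasurableSpace (k l : ℕ) : MeasurableSpace (Matrix (Fin k) (Fin l) ℝ) :=
  inferInstanceAs (MeasurableSpace (Fin k → Fin l → ℝ))

/-- The law of a random `k × l` real matrix whose entries are i.i.d. centred Gaussian random
variables of variance `v`. -/
def gaussianMatrix (k l : ℕ) (v : ℝ≥0) : Measure (Matrix (Fin k) (Fin l) ℝ) :=
  (Measure.pi fun _ : Fin k => Measure.pi fun _ : Fin l => gaussianReal 0 v).map Matrix.of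

/-- The joint law of `(X, W)`: the sensing matrix `X` has i.i.d. `N(0, 1)` entries, the noise `W`
has i.i.d. `N(0, σ²)` entries, and the two are independent. -/
def sensingLaw (n p m : ℕ) (σ : ℝ) :
    Measure (Matrix (Fin n) (Fin p) ℝ × Matrix (Fin n) (Fin m) ℝ) :=
  (gaussianMatrix n p 1).prod (gaussianMatrix n m (Real.toNNReal (σ ^ 2)))

/-- The observation `Y = Π X B + W`, where `Π` is the permutation matrix of `π`,
that is, `(Π X) i j = X (π i) j`. -/
def observation {n p m : ℕ} (B : Matrix (Fin p) (Fin m) ℝ) (π : Equiv.Perm (Fin n))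
    (X : Matrix (Fin n) (Fin p) ℝ) (W : Matrix (Fin n) (Fin m) ℝ) :
    Matrix (Fin n) (Fin m) ℝ :=
  π.permMatrix ℝ * X * B + W

/-- An estimator of the permutation: a measurable function of the data `(X, Y)` with values in the
finite (discrete) set of all permutations. -/
structure Estimator (n p m : ℕ) where
  /-- The estimated permutation. -/
  toFun : Matrix (Fin n) (Fin p) ℝ → Matrix (Fin n) (Fin m) ℝ → Equiv.Perm (Fin n)
  /-- Measurability for the discrete σ-algebra on the set of permutations. -/
  measurable_toFun : ∀ π : Equiv.Perm (Fin n),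
    MeasurableSet {z : Matrix (Fin n) (Fin p) ℝ × Matrix (Fin n) (Fin m) ℝ | toFun z.1 z.2 = π}

/-- The probability, over `(X, W)`, that the estimator does not recover the true permutation `π`
exactly from `X` and `Y = Π X B + W`. -/
def failureProb {n p m : ℕ} (σ : ℝ) (B : Matrix (Fin p) (Fin m) ℝ) (g : Estimator n p m)
    (π : Equiv.Perm (Fin n)) : ℝ≥0∞ :=
  sensingLaw n p m σ {z | g.toFun z.1 (observation B π z.1 z.2) ≠ π}

/-- The minimax probability of failing to recover a permutation in `H` exactly. The matrix `B` (as
well as `σ` and `H`) is fixed before the infimum over the estimators is taken, so that they are all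
known to the statistician. -/
def minimaxFailureProb {n p m : ℕ} (σ : ℝ) (B : Matrix (Fin p) (Fin m) ℝ)
    (H : Finset (Equiv.Perm (Fin n))) : ℝ≥0∞ :=
  ⨅ g : Estimator n p m, ⨆ π ∈ H, failureProb σ B g π

end

/-! This is Fano's argument with an explicit reference law. Each row of `Y` is Gaussian with
covariance `BᵀB + σ²I = σ²RᵀR`, whatever the permutation. So compare the law of `(X, Y)` under each
`π` with the single law of `(X, ZR)`, where `Z` is a copy of the noise independent of `X`.

The log-likelihood ratio has mean `(n/2) log det(I + BᵀB/σ²)`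
(`integrable_and_integral_logDensityRatio`). Under the reference law the events that the estimator
outputs `π` are disjoint, so their masses sum to at most one (via
`setIntegral_exp_neg_logDensityRatio`). The Fano bound `log_card_mul_sum_measureReal_le` follows
from `1 + t ≤ exp t` and turns these two facts into an upper bound for the average success
probability. If every failure probability were below 1/2, this average would exceed 1/2, against the
assumed inequality. -/

section LinearAlgebra

/-! ### Positive semidefinite matrices: square factors and determinants. -/

open Matrix

open scoped MatrixOrder in
theorem Matrix.PosSemidef.exists_transpose_mul_self {m : ℕ} {A : Matrix (Fin m) (Fin m) ℝ}
    (hA : A.PosSemidef) : ∃ R : Matrix (Fin m) (Fin m) ℝ, A = Rᵀ * R := by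
  have h0 : (0 : Matrix (Fin m) (Fin m) ℝ) ≤ A := Matrix.nonneg_iff_posSemidef.2 hA
  have hs : (CFC.sqrt A).PosSemidef := Matrix.nonneg_iff_posSemidef.1 (CFC.sqrt_nonneg A)
  refine ⟨CFC.sqrt A, ?_⟩
  have := hs.isHermitian.eq
  rw [conjTranspose_eq_transpose_of_trivial] at this
  rw [this, CFC.sqrt_mul_sqrt_self A h0]

theorem Matrix.PosSemidef.one_le_det_one_add {m : ℕ} {A : Matrix (Fin m) (Fin m) ℝ}
    (hA : A.PosSemidef) : 1 ≤ (1 + A).det := by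
  -- Evaluating the characteristic polynomial at -1 in two ways gives `det (1 + A)` as the product
  -- of the `1 + λᵢ`.
  have h1 : A.charpoly.eval (-1) = (-1) ^ m * (1 + A).det := by
    have h := det_neg (1 + A)
    rw [Fintype.card_fin] at h
    rw [eval_charpoly, ← h]
    congr 1
    ext i j
    by_cases h : i = j <;> simp [Matrix.scalar_apply, h, sub_eq_add_neg, add_comm]
  have h2 : A.charpoly.eval (-1) = (-1) ^ m * ∏ i, (1 + hA.isHermitian.eigenvalues i) := by
    rw [hA.isHermitian.charpoly_eq, Polynomial.eval_prod]
    have : ∀ i, Polynomial.eval (-1 : ℝ) (Polynomial.X -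
        Polynomial.C ((hA.isHermitian.eigenvalues i : ℝ))) =
        (-1) * (1 + hA.isHermitian.eigenvalues i) := by
      intro i; simp; ring
    simp only [RCLike.ofReal_real_eq_id, id, this, Finset.prod_mul_distrib]
    simp
  rw [h1] at h2
  rw [mul_left_cancel₀ (by simp) h2]
  calc (1 : ℝ) = ∏ _i : Fin m, 1 := by simp
    _ ≤ _ := Finset.prod_le_prod (by simp) fun i _ => by
      linarith [hA.eigenvalues_nonneg i]

theorem posSemidef_inv_sq_smul_transpose_mul_self {p m : ℕ} (σ : ℝ)
    (B : Matrix (Fin p) (Fin m) ℝ) : ((σ ^ 2)⁻¹ • (B.transpose * B)).PosSemidef := by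
  have := Matrix.posSemidef_conjTranspose_mul_self B
  rw [Matrix.conjTranspose_eq_transpose_of_trivial] at this
  exact this.smul (by positivity)

/-- The sum of the squares of the entries of a matrix. -/
noncomputable def frobeniusSq {k l : ℕ} (M : Matrix (Fin k) (Fin l) ℝ) : ℝ := ∑ i, ∑ j, M i j ^ 2

end LinearAlgebra

/-! ### Lebesgue densities of Gaussian matrices. -/

section Density

/-- It suffices to compare on boxes, where the indicator splits over the coordinates and Fubini
factors the integral. It is applied twice below, to the entries of a row and then to the rows. -/
theorem MeasureTheory.Measure.pi_withDensity_ofReal {ι α : Type*} [Fintype ι]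
    [MeasurableSpace α] (μ : Measure α) [SigmaFinite μ] {f : α → ℝ}
    (hf : Integrable f μ) (hf0 : ∀ x, 0 ≤ f x) :
    (Measure.pi fun _ : ι => μ.withDensity fun x => ENNReal.ofReal (f x)) =
      (Measure.pi fun _ : ι => μ).withDensity fun x => ENNReal.ofReal (∏ i, f (x i)) := by
  have : SigmaFinite (μ.withDensity fun x => ENNReal.ofReal (f x)) :=
    SigmaFinite.withDensity_ofReal _
  refine Measure.pi_eq fun s hs => ?_
  rw [withDensity_apply _ (MeasurableSet.univ_pi hs), ← lintegral_indicator
    (MeasurableSet.univ_pi hs)]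
  have h1 : ∀ x : ι → α, (Set.univ.pi s).indicator
      (fun x => ENNReal.ofReal (∏ i, f (x i))) x =
      ENNReal.ofReal (∏ i, (s i).indicator f (x i)) := by
    intro x
    by_cases hx : x ∈ Set.univ.pi s
    · rw [Set.indicator_of_mem hx]
      congr 1
      exact Finset.prod_congr rfl fun i _ => by
        rw [Set.indicator_of_mem (hx i (Set.mem_univ i))]
    · rw [Set.indicator_of_notMem hx]
      simp only [Set.mem_pi, Set.mem_univ, true_implies, not_forall] at hx
      obtain ⟨i, hi⟩ := hx
      rw [Finset.prod_eq_zero (Finset.mem_univ i) (Set.indicator_of_notMem hi f),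
        ENNReal.ofReal_zero]
  have hi0 : ∀ i x, 0 ≤ (s i).indicator f x := fun i x =>
    Set.indicator_nonneg (fun y _ => hf0 y) x
  simp_rw [h1]
  rw [← ofReal_integral_eq_lintegral_ofReal
      (Integrable.fintype_prod fun i => hf.indicator (hs i))
      (ae_of_all _ fun x => Finset.prod_nonneg fun i _ => hi0 i _),
    integral_fintype_prod_eq_prod (fun i => (s i).indicator f),
    ENNReal.ofReal_prod_of_nonneg fun i _ => integral_nonneg (hi0 i)]
  refine Finset.prod_congr rfl fun i _ => ?_
  rw [withDensity_apply _ (hs i), ofReal_integral_eq_lintegral_ofReal (hf.indicator (hs i))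
    (ae_of_all _ (hi0 i)), ← lintegral_indicator (hs i)]
  congr 1
  ext x
  by_cases hx : x ∈ s i <;> simp [hx]

/-- The density of a matrix with i.i.d. centred Gaussian entries. -/
noncomputable def gaussianMatrixPDF (k l : ℕ) (v : ℝ≥0) (M : Fin k → Fin l → ℝ) : ℝ :=
  ∏ i, ∏ j, gaussianPDFReal 0 v (M i j)

theorem gaussianMatrix_eq_pi (k l : ℕ) (v : ℝ≥0) :
    gaussianMatrix k l v = (Measure.pi fun _ : Fin k => Measure.pi fun _ : Fin l =>
      gaussianReal 0 v : Measure (Fin k → Fin l → ℝ)) := by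
  unfold gaussianMatrix
  exact Measure.map_id

instance isProbabilityMeasure_gaussianMatrix (k l : ℕ) (v : ℝ≥0) :
    IsProbabilityMeasure (gaussianMatrix k l v) := by
  rw [gaussianMatrix_eq_pi]
  exact inferInstanceAs (IsProbabilityMeasure (Measure.pi fun _ : Fin k =>
    Measure.pi fun _ : Fin l => gaussianReal 0 v : Measure (Fin k → Fin l → ℝ)))

theorem gaussianMatrixPDF_eq (k l : ℕ) (v : ℝ≥0) (M : Matrix (Fin k) (Fin l) ℝ) :
    gaussianMatrixPDF k l v M =
      ((Real.sqrt (2 * Real.pi * v))⁻¹) ^ (l * k) * Real.exp (-(frobeniusSq M / (2 * v))) := by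
  simp only [gaussianMatrixPDF, gaussianPDFReal_def, Finset.prod_mul_distrib, Finset.prod_const,
    ← Real.exp_sum, Finset.card_univ, Fintype.card_fin, ← pow_mul, frobeniusSq]
  congr 2
  simp [neg_div, Finset.sum_div]

theorem gaussianMatrix_eq_withDensity (k l : ℕ) {v : ℝ≥0} (hv : v ≠ 0) :
    gaussianMatrix k l v = (volume : Measure (Fin k → Fin l → ℝ)).withDensity
      fun M => ENNReal.ofReal (gaussianMatrixPDF k l v M) := by
  have h1 : gaussianReal 0 v = (volume : Measure ℝ).withDensity
      fun x => ENNReal.ofReal (gaussianPDFReal 0 v x) := gaussianReal_of_var_ne_zero 0 hv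
  rw [gaussianMatrix_eq_pi, h1,
    Measure.pi_withDensity_ofReal volume (integrable_gaussianPDFReal 0 v)
      (gaussianPDFReal_nonneg 0 v),
    Measure.pi_withDensity_ofReal _
      (Integrable.fintype_prod fun _ => integrable_gaussianPDFReal 0 v)
      (fun x => Finset.prod_nonneg fun i _ => gaussianPDFReal_nonneg 0 v _)]
  rfl

theorem measurable_gaussianMatrixPDF (k l : ℕ) (v : ℝ≥0) :
    Measurable (gaussianMatrixPDF k l v) := by
  unfold gaussianMatrixPDF
  refine Finset.measurable_prod _ fun i _ => Finset.measurable_prod _ fun j _ => ?_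
  exact (measurable_gaussianPDFReal 0 v).comp (by fun_prop)

theorem lintegral_gaussianMatrix (k l : ℕ) {v : ℝ≥0} (hv : v ≠ 0)
    {f : Matrix (Fin k) (Fin l) ℝ → ℝ≥0∞} (hf : Measurable f) :
    ∫⁻ M, f M ∂(gaussianMatrix k l v) =
      ∫⁻ M : Fin k → Fin l → ℝ,
        ENNReal.ofReal (gaussianMatrixPDF k l v M) * f (Matrix.of M) := by
  rw [gaussianMatrix_eq_withDensity k l hv]
  exact lintegral_withDensity_eq_lintegral_mul _
    (measurable_gaussianMatrixPDF k l v).ennreal_ofReal hf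

/-- Right multiplication by an invertible matrix scales Lebesgue measure on matrices with `n` rows
by the `n`-th power of the inverse of the determinant. -/
theorem map_mul_right_volume (n m : ℕ) {R : Matrix (Fin m) (Fin m) ℝ} (hR : R.det ≠ 0) :
    (volume : Measure (Fin n → Fin m → ℝ)).map (fun M i => Matrix.toLin' R.transpose (M i)) =
      ENNReal.ofReal (|R.det⁻¹|) ^ n • volume := by
  have hT : R.transpose.det ≠ 0 := by rwa [Matrix.det_transpose]
  have h := Real.map_matrix_volume_pi_eq_smul_volume_pi hT
  rw [Matrix.det_transpose] at h
  have : SigmaFinite ((volume : Measure (Fin m → ℝ)).map (Matrix.toLin' R.transpose)) := by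
    rw [h]; exact SMul.sigmaFinite _
  have hmeas : Measurable (Matrix.toLin' R.transpose) :=
    (LinearMap.continuous_of_finiteDimensional _).measurable
  rw [volume_pi, Measure.pi_map_pi fun _ => hmeas.aemeasurable]
  refine Measure.pi_eq fun s hs => ?_
  rw [h]
  simp [Measure.smul_apply, Finset.prod_mul_distrib, Measure.pi_pi]

end Density

/-! ### Change of measure from `C + W` to `Z * R`. -/

section ChangeOfMeasure

variable {α : Type*} [MeasurableSpace α] {k l : ℕ}

theorem measurable_matrix_of_entries {f : α → Matrix (Fin k) (Fin l) ℝ}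
    (h : ∀ i j, Measurable fun a => f a i j) : Measurable f :=
  measurable_pi_iff.2 fun i => measurable_pi_iff.2 fun j => h i j

theorem measurable_entry {f : α → Matrix (Fin k) (Fin l) ℝ} (h : Measurable f) (i : Fin k)
    (j : Fin l) : Measurable fun a => f a i j :=
  measurable_pi_iff.1 (measurable_pi_iff.1 h i) j

theorem measurable_matrix_add {f g : α → Matrix (Fin k) (Fin l) ℝ} (hf : Measurable f)
    (hg : Measurable g) : Measurable fun a => f a + g a :=
  measurable_matrix_of_entries fun i j => by
    simp only [Matrix.add_apply]
    exact (measurable_entry hf i j).add (measurable_entry hg i j)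

theorem measurable_matrix_mul_const {l' : ℕ} {f : α → Matrix (Fin k) (Fin l) ℝ}
    (hf : Measurable f) (A : Matrix (Fin l) (Fin l') ℝ) : Measurable fun a => f a * A :=
  measurable_matrix_of_entries fun i j => by
    simp only [Matrix.mul_apply]
    exact Finset.measurable_sum _ fun a _ => (measurable_entry hf i a).mul_const _

theorem measurable_const_mul_matrix {k' : ℕ} {f : α → Matrix (Fin k) (Fin l) ℝ}
    (hf : Measurable f) (A : Matrix (Fin k') (Fin k) ℝ) : Measurable fun a => A * f a :=
  measurable_matrix_of_entries fun i j => by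
    simp only [Matrix.mul_apply]
    exact Finset.measurable_sum _ fun a _ => (measurable_entry hf a j).const_mul _

theorem measurable_frobeniusSq {f : α → Matrix (Fin k) (Fin l) ℝ} (hf : Measurable f) :
    Measurable fun a => frobeniusSq (f a) :=
  Finset.measurable_sum _ fun i _ => Finset.measurable_sum _ fun j _ =>
    (measurable_entry hf i j).pow_const 2

/-- The logarithm of the density of `C + W` with respect to `Z * R`, evaluated at `C + W`, where `W`
and `Z` have i.i.d. centred Gaussian entries of variance `v`. -/
noncomputable def logDensityRatio (v : ℝ≥0) (R : Matrix (Fin l) (Fin l) ℝ)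
    (C W : Matrix (Fin k) (Fin l) ℝ) : ℝ :=
  (frobeniusSq ((C + W) * R⁻¹) - frobeniusSq W) / (2 * v) + k * Real.log |R.det|

theorem measurable_logDensityRatio (v : ℝ≥0) (R : Matrix (Fin l) (Fin l) ℝ)
    {f g : α → Matrix (Fin k) (Fin l) ℝ} (hf : Measurable f) (hg : Measurable g) :
    Measurable fun a => logDensityRatio v R (f a) (g a) :=
  (((measurable_frobeniusSq (measurable_matrix_mul_const (measurable_matrix_add hf hg) _)).sub
    (measurable_frobeniusSq hg)).div_const _).add_const _

theorem gaussianMatrixPDF_mul_exp_neg_logDensityRatio (v : ℝ≥0)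
    {R : Matrix (Fin l) (Fin l) ℝ} (hR : R.det ≠ 0) (C W : Matrix (Fin k) (Fin l) ℝ) :
    gaussianMatrixPDF k l v W * Real.exp (-logDensityRatio v R C W) =
      |R.det⁻¹| ^ k * gaussianMatrixPDF k l v ((C + W) * R⁻¹) := by
  rw [gaussianMatrixPDF_eq, gaussianMatrixPDF_eq, logDensityRatio]
  have h1 : |R.det⁻¹| ^ k = Real.exp (-(k * Real.log |R.det|)) := by
    rw [abs_inv, ← Real.log_pow, ← Real.log_inv, ← inv_pow, Real.exp_log]
    positivity
  rw [h1, mul_assoc, ← Real.exp_add, mul_left_comm, ← Real.exp_add]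
  congr 2
  ring

theorem gaussianMatrixPDF_nonneg (v : ℝ≥0) (M : Fin k → Fin l → ℝ) :
    0 ≤ gaussianMatrixPDF k l v M :=
  Finset.prod_nonneg fun _ _ => Finset.prod_nonneg fun _ _ => gaussianPDFReal_nonneg _ _ _

/-- The weight replaces the density of `W` by that of `(C + W) * R⁻¹` times a Jacobian. Translation
invariance removes `C`, and the substitution `Y = Z * R` absorbs the Jacobian. The result no longer
depends on `C`. -/
theorem lintegral_exp_neg_logDensityRatio {v : ℝ≥0} (hv : v ≠ 0)
    {R : Matrix (Fin l) (Fin l) ℝ} (hR : R.det ≠ 0) (C : Matrix (Fin k) (Fin l) ℝ)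
    {h : Matrix (Fin k) (Fin l) ℝ → ℝ≥0∞} (hh : Measurable h) :
    ∫⁻ W, h (C + W) * ENNReal.ofReal (Real.exp (-logDensityRatio v R C W))
      ∂(gaussianMatrix k l v) = ∫⁻ Z, h (Z * R) ∂(gaussianMatrix k l v) := by
  have hφ : Measurable fun Y : Matrix (Fin k) (Fin l) ℝ =>
      ENNReal.ofReal (gaussianMatrixPDF k l v (Y * R⁻¹)) :=
    ((measurable_gaussianMatrixPDF k l v).comp
      (measurable_matrix_mul_const measurable_id _)).ennreal_ofReal
  let F : (Fin k → Fin l → ℝ) → ℝ≥0∞ := fun Y =>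
    ENNReal.ofReal (gaussianMatrixPDF k l v (Matrix.of Y * R⁻¹)) * h (Matrix.of Y)
  have hF : Measurable F := hφ.mul hh
  let C' : Fin k → Fin l → ℝ := C
  rw [lintegral_gaussianMatrix k l hv, lintegral_gaussianMatrix k l hv]
  · have h1 : ∀ W : Fin k → Fin l → ℝ, ENNReal.ofReal (gaussianMatrixPDF k l v W) *
        (h (C + Matrix.of W) *
          ENNReal.ofReal (Real.exp (-logDensityRatio v R C (Matrix.of W)))) =
        ENNReal.ofReal |R.det⁻¹| ^ k * F (C' + W) := by
      intro W
      rw [mul_left_comm, ← ENNReal.ofReal_mul (gaussianMatrixPDF_nonneg v W),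
        show gaussianMatrixPDF k l v W = gaussianMatrixPDF k l v (Matrix.of W) from rfl,
        gaussianMatrixPDF_mul_exp_neg_logDensityRatio v hR C (Matrix.of W),
        ENNReal.ofReal_mul (by positivity), ENNReal.ofReal_pow (abs_nonneg _), mul_left_comm]
      simp only [F]
      rw [mul_comm (h _)]
      rfl
    have h2 : ∀ Z : Fin k → Fin l → ℝ, ENNReal.ofReal (gaussianMatrixPDF k l v Z) *
        h (Matrix.of Z * R) =
        F (fun i => Matrix.toLin' R.transpose (Z i)) := by
      intro Z
      have h3 : Matrix.of (fun i => Matrix.toLin' R.transpose (Z i)) = Matrix.of Z * R := by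
        ext i j
        simp [Matrix.mulVec, dotProduct, Matrix.mul_apply, mul_comm]
      simp only [F]
      rw [h3, Matrix.mul_assoc, Matrix.mul_nonsing_inv R (isUnit_iff_ne_zero.2 hR), Matrix.mul_one]
      rfl
    have hlin : Measurable fun (Z : Fin k → Fin l → ℝ) i => Matrix.toLin' R.transpose (Z i) :=
      measurable_pi_iff.2 fun i =>
        (LinearMap.continuous_of_finiteDimensional _).measurable.comp (measurable_pi_apply i)
    simp_rw [h1, h2]
    have hF' : Measurable fun W => F (C' + W) := hF.comp (measurable_const_add C')
    rw [lintegral_const_mul _ hF',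
      lintegral_add_left_eq_self F, ← lintegral_map hF hlin, map_mul_right_volume k l hR,
      lintegral_smul_measure, smul_eq_mul]
  · exact hh.comp (measurable_matrix_mul_const measurable_id _)
  · exact (hh.comp (measurable_matrix_add measurable_const measurable_id)).mul
      (measurable_logDensityRatio v R measurable_const measurable_id).neg.exp.ennreal_ofReal

end ChangeOfMeasure

/-! ### First and second moments of linear forms in a Gaussian row. -/

section Moments

theorem measurePreserving_entry (k l : ℕ) (v : ℝ≥0) (i : Fin k) (j : Fin l) :
    MeasurePreserving (fun M : Fin k → Fin l → ℝ => M i j)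
      (Measure.pi fun _ : Fin k => Measure.pi fun _ : Fin l => gaussianReal 0 v)
      (gaussianReal 0 v) :=
  (measurePreserving_eval (fun _ : Fin l => gaussianReal 0 v) j).comp
    (measurePreserving_eval (fun _ : Fin k => Measure.pi fun _ : Fin l => gaussianReal 0 v) i)

theorem memLp_entry (k l : ℕ) (v : ℝ≥0) (i : Fin k) (j : Fin l) :
    MemLp (fun M : Matrix (Fin k) (Fin l) ℝ => M i j) 2 (gaussianMatrix k l v) := by
  have h1 := measurePreserving_entry k l v i j
  rw [gaussianMatrix_eq_pi]
  exact (memLp_id_gaussianReal' (μ := 0) (v := v) 2 (by simp)).comp_measurePreserving h1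

theorem memLp_row_sum (k l : ℕ) (v : ℝ≥0) (i : Fin k) (c : Fin l → ℝ) :
    MemLp (fun M : Matrix (Fin k) (Fin l) ℝ => ∑ j, M i j * c j) 2 (gaussianMatrix k l v) :=
  memLp_finsetSum _ fun j _ => (memLp_entry k l v i j).mul_const _

theorem integral_row_sum (k l : ℕ) (v : ℝ≥0) (i : Fin k) (c : Fin l → ℝ) :
    ∫ M : Matrix (Fin k) (Fin l) ℝ, ∑ j, M i j * c j ∂(gaussianMatrix k l v) = 0 := by
  rw [integral_finsetSum _ fun j _ => ((memLp_entry k l v i j).integrable (by simp)).mul_const _]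
  refine Finset.sum_eq_zero fun j _ => ?_
  have h1 := measurePreserving_entry k l v i j
  rw [integral_mul_const, gaussianMatrix_eq_pi]
  have h2 := h1.map_eq ▸ integral_map h1.measurable.aemeasurable
    (f := fun x : ℝ => x) (by fun_prop)
  rw [integral_id_gaussianReal] at h2
  erw [← h2, zero_mul]

/-- The form is centred, so its second moment is a variance, which is additive over the independent
entries of the row. -/
theorem integral_row_sum_sq (k l : ℕ) (v : ℝ≥0) (i : Fin k) (c : Fin l → ℝ) :
    ∫ M : Matrix (Fin k) (Fin l) ℝ, (∑ j, M i j * c j) ^ 2 ∂(gaussianMatrix k l v) =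
      v * ∑ j, c j ^ 2 := by
  rw [← variance_of_integral_eq_zero (memLp_row_sum k l v i c).aemeasurable
    (integral_row_sum k l v i c), gaussianMatrix_eq_pi]
  have h1 := measurePreserving_eval
    (fun _ : Fin k => Measure.pi fun _ : Fin l => gaussianReal 0 v) i
  have h2 := variance_map (μ := Measure.pi fun _ : Fin k => Measure.pi fun _ : Fin l => gaussianReal 0 v)
    (X := fun x : Fin l → ℝ => ∑ j, x j * c j)
    (Measurable.aemeasurable (by fun_prop)) h1.measurable.aemeasurable
  rw [h1.map_eq] at h2
  refine h2.symm.trans ?_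
  have h3 : (fun x : Fin l → ℝ => ∑ j, x j * c j) =
      ∑ j, fun x : Fin l → ℝ => (fun y : ℝ => c j * id y) (x j) := by
    ext x; simp [mul_comm]
  rw [h3, variance_sum_pi fun j => (memLp_id_gaussianReal' 2 (by simp)).const_mul _]
  simp_rw [variance_const_mul, variance_id_gaussianReal]
  rw [Finset.mul_sum]
  exact Finset.sum_congr rfl fun j _ => mul_comm _ _

end Moments

/-! ### Mean of the log-likelihood ratio. -/

section LogDensityRatioMean

open Matrix

theorem frobeniusSq_eq_trace {k l : ℕ} (M : Matrix (Fin k) (Fin l) ℝ) :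
    frobeniusSq M = (Mᵀ * M).trace := by
  simp only [frobeniusSq, Matrix.trace, Matrix.diag, Matrix.mul_apply, Matrix.transpose_apply, sq]
  exact Finset.sum_comm

instance isProbabilityMeasure_sensingLaw (n p m : ℕ) (σ : ℝ) :
    IsProbabilityMeasure (sensingLaw n p m σ) := by
  unfold sensingLaw
  infer_instance

variable {n p m : ℕ} {σ : ℝ}

theorem integrable_and_integral_sq_add {α β : Type*} [MeasurableSpace α] [MeasurableSpace β]
    {μ : Measure α} {ν : Measure β} [IsProbabilityMeasure μ] [IsProbabilityMeasure ν]
    {f : α → ℝ} {g : β → ℝ} (hf : MemLp f 2 μ) (hg : MemLp g 2 ν) (hg0 : ∫ y, g y ∂ν = 0) :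
    Integrable (fun z : α × β => (f z.1 + g z.2) ^ 2) (μ.prod ν) ∧
      ∫ z, (f z.1 + g z.2) ^ 2 ∂(μ.prod ν) = ∫ x, f x ^ 2 ∂μ + ∫ y, g y ^ 2 ∂ν := by
  have h1 : Integrable (fun z : α × β => f z.1 ^ 2) (μ.prod ν) :=
    hf.integrable_sq.comp_fst ν
  have h2 : Integrable (fun z : α × β => g z.2 ^ 2) (μ.prod ν) :=
    hg.integrable_sq.comp_snd μ
  have h3 : Integrable (fun z : α × β => 2 * (f z.1 * g z.2)) (μ.prod ν) :=
    ((hf.integrable (by simp)).mul_prod (hg.integrable (by simp))).const_mul 2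
  have h4 : ∀ z : α × β, (f z.1 + g z.2) ^ 2 = f z.1 ^ 2 + 2 * (f z.1 * g z.2) + g z.2 ^ 2 :=
    fun z => by ring
  simp_rw [h4]
  refine ⟨(h1.add h3).add h2, ?_⟩
  rw [integral_add (f := fun z => f z.1 ^ 2 + 2 * (f z.1 * g z.2)) (h1.add h3) h2, integral_add h1 h3, integral_const_mul,
    integral_prod_mul, hg0, integral_fun_fst (fun x => f x ^ 2),
    integral_fun_snd (fun y => g y ^ 2)]
  simp

theorem observation_mul_apply (B : Matrix (Fin p) (Fin m) ℝ) (π : Equiv.Perm (Fin n))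
    (X : Matrix (Fin n) (Fin p) ℝ) (W : Matrix (Fin n) (Fin m) ℝ)
    (S : Matrix (Fin m) (Fin m) ℝ) (i : Fin n) (j : Fin m) :
    ((π.permMatrix ℝ * X * B + W) * S) i j =
      ∑ a, X (π i) a * (B * S) a j + ∑ b, W i b * S b j := by
  have h : π.permMatrix ℝ * X = X.submatrix π id := PEquiv.toMatrix_toPEquiv_mul π X
  rw [Matrix.add_mul, Matrix.mul_assoc, h, Matrix.add_apply, Matrix.mul_apply, Matrix.mul_apply]
  rfl

/-- The permutation only selects which row of `X` enters, and all rows have the same law, so `π`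
drops out. The cross terms between `X` and `W` vanish by independence and centring. -/
theorem integrable_and_integral_frobeniusSq_observation (B : Matrix (Fin p) (Fin m) ℝ)
    (π : Equiv.Perm (Fin n)) (S : Matrix (Fin m) (Fin m) ℝ) :
    Integrable (fun z => frobeniusSq ((π.permMatrix ℝ * z.1 * B + z.2) * S))
        (sensingLaw n p m σ) ∧
      ∫ z, frobeniusSq ((π.permMatrix ℝ * z.1 * B + z.2) * S) ∂(sensingLaw n p m σ) =
        n * (Sᵀ * (Bᵀ * B + σ ^ 2 • (1 : Matrix (Fin m) (Fin m) ℝ)) * S).trace := by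
  have h := fun (i : Fin n) (j : Fin m) => integrable_and_integral_sq_add
    (memLp_row_sum n p 1 (π i) fun a => (B * S) a j)
    (memLp_row_sum n m (Real.toNNReal (σ ^ 2)) i fun b => S b j)
    (integral_row_sum n m (Real.toNNReal (σ ^ 2)) i fun b => S b j)
  simp only [frobeniusSq, observation_mul_apply, sensingLaw]
  refine ⟨integrable_finsetSum _ fun i _ => integrable_finsetSum _ fun j _ => (h i j).1, ?_⟩
  rw [integral_finsetSum _ fun i _ => integrable_finsetSum _ fun j _ => (h i j).1]
  have h2 : ∀ i : Fin n, ∫ z, ∑ j, (∑ a, z.1 (π i) a * (B * S) a j + ∑ b, z.2 i b * S b j) ^ 2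
      ∂((gaussianMatrix n p 1).prod (gaussianMatrix n m (Real.toNNReal (σ ^ 2)))) =
      (Sᵀ * (Bᵀ * B + σ ^ 2 • (1 : Matrix (Fin m) (Fin m) ℝ)) * S).trace := by
    intro i
    rw [integral_finsetSum _ fun j _ => (h i j).1]
    have h3 : Sᵀ * (Bᵀ * B + σ ^ 2 • (1 : Matrix (Fin m) (Fin m) ℝ)) * S =
        (B * S)ᵀ * (B * S) + σ ^ 2 • (Sᵀ * S) := by
      simp [Matrix.mul_add, Matrix.add_mul, Matrix.transpose_mul, Matrix.mul_assoc]
    rw [h3, Matrix.trace_add, Matrix.trace_smul, ← frobeniusSq_eq_trace, ← frobeniusSq_eq_trace]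
    simp only [frobeniusSq]
    rw [Finset.sum_comm, Finset.sum_comm (f := fun i j => S i j ^ 2), smul_eq_mul,
      Finset.mul_sum, ← Finset.sum_add_distrib]
    refine Finset.sum_congr rfl fun j _ => ?_
    refine (h i j).2.trans ?_
    rw [integral_row_sum_sq, integral_row_sum_sq, Real.coe_toNNReal _ (sq_nonneg σ)]
    simp
  simp_rw [h2]
  simp

theorem integrable_and_integral_frobeniusSq_noise :
    Integrable (fun z : Matrix (Fin n) (Fin p) ℝ × Matrix (Fin n) (Fin m) ℝ => frobeniusSq z.2)
        (sensingLaw n p m σ) ∧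
      ∫ z, frobeniusSq z.2 ∂(sensingLaw n p m σ) = n * (m * σ ^ 2) := by
  -- With zero signal and `S = 1`, the observation is the noise itself.
  have h := integrable_and_integral_frobeniusSq_observation (n := n) (σ := σ)
    (0 : Matrix (Fin p) (Fin m) ℝ) 1 1
  simpa [mul_comm] using h

/-- `R⁻¹` whitens the rows of the observation back to covariance `σ²I`, so the two quadratic terms
have equal means and cancel. Only `n log |det R|` is left, half of `n log det (RᵀR)`. -/
theorem integrable_and_integral_logDensityRatio (hσ : 0 < σ) (B : Matrix (Fin p) (Fin m) ℝ)
    {R : Matrix (Fin m) (Fin m) ℝ} (hR : 1 + (σ ^ 2)⁻¹ • (Bᵀ * B) = Rᵀ * R) (hdet : R.det ≠ 0)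
    (π : Equiv.Perm (Fin n)) :
    Integrable (fun z => logDensityRatio (Real.toNNReal (σ ^ 2)) R (π.permMatrix ℝ * z.1 * B) z.2)
        (sensingLaw n p m σ) ∧
      ∫ z, logDensityRatio (Real.toNNReal (σ ^ 2)) R (π.permMatrix ℝ * z.1 * B) z.2
        ∂(sensingLaw n p m σ) = n / 2 * Real.log (1 + (σ ^ 2)⁻¹ • (Bᵀ * B)).det := by
  have hu : IsUnit R.det := isUnit_iff_ne_zero.2 hdet
  have hσ2 : σ ^ 2 ≠ 0 := by positivity
  have h1 := integrable_and_integral_frobeniusSq_observation (n := n) (σ := σ) B π R⁻¹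
  have h2 := integrable_and_integral_frobeniusSq_noise (n := n) (p := p) (m := m) (σ := σ)
  have h3 : (R⁻¹)ᵀ * (Bᵀ * B + σ ^ 2 • (1 : Matrix (Fin m) (Fin m) ℝ)) * R⁻¹ =
      σ ^ 2 • (1 : Matrix (Fin m) (Fin m) ℝ) := by
    have : Bᵀ * B + σ ^ 2 • (1 : Matrix (Fin m) (Fin m) ℝ) = σ ^ 2 • (Rᵀ * R) := by
      rw [← hR, smul_add, smul_smul, mul_inv_cancel₀ hσ2, one_smul, add_comm]
    rw [this, Matrix.mul_smul, Matrix.smul_mul, Matrix.mul_assoc, Matrix.mul_assoc Rᵀ,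
      Matrix.mul_nonsing_inv R hu, Matrix.mul_one, ← Matrix.transpose_mul,
      Matrix.mul_nonsing_inv R hu, Matrix.transpose_one]
  have h4 : ∫ z, frobeniusSq ((π.permMatrix ℝ * z.1 * B + z.2) * R⁻¹) ∂(sensingLaw n p m σ) =
      n * (m * σ ^ 2) := by
    rw [h1.2, h3]
    simp [mul_comm]
  have h5 := (h1.1.sub h2.1).div_const (2 * (Real.toNNReal (σ ^ 2) : ℝ))
  refine ⟨h5.add (integrable_const _), ?_⟩
  unfold logDensityRatio
  refine (integral_add h5 (integrable_const _)).trans ?_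
  have h6 : ∫ z, (frobeniusSq ((π.permMatrix ℝ * z.1 * B + z.2) * R⁻¹) - frobeniusSq z.2) /
      (2 * (Real.toNNReal (σ ^ 2) : ℝ)) ∂(sensingLaw n p m σ) = 0 := by
    rw [integral_div]
    refine div_eq_zero_iff.2 (Or.inl ((integral_sub h1.1 h2.1).trans ?_))
    rw [h4, h2.2, sub_self]
  refine (congrArg₂ (· + ·) h6 rfl).trans ?_
  rw [hR, Matrix.det_mul, Matrix.det_transpose, ← sq, ← sq_abs, Real.log_pow]
  simp
  ring

end LogDensityRatioMean

/-! ### Fano's inequality. -/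

section Fano

/-- Fano's inequality, with the densities replaced by log-likelihood ratios `L a` of mean `I` with
respect to a common reference law, under which the decision events `E a` have total mass at most
one. -/
theorem log_card_mul_sum_measureReal_le {ι Ω : Type*} [MeasurableSpace Ω] {P : Measure Ω}
    [IsProbabilityMeasure P] {H : Finset ι} (hH : H.Nonempty) {L : ι → Ω → ℝ} {I : ℝ}
    {E : ι → Set Ω} (hE : ∀ a, MeasurableSet (E a)) (hL : ∀ a, Integrable (L a) P)
    (hI : ∀ a, ∫ z, L a z ∂P = I) (hexp : ∀ a, Integrable (fun z => Real.exp (-L a z)) P)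
    (hexp_le : ∀ a, ∫ z, Real.exp (-L a z) ∂P ≤ 1)
    (hsum : ∑ a ∈ H, ∫ z in E a, Real.exp (-L a z) ∂P ≤ 1) :
    Real.log H.card * ∑ a ∈ H, P.real (E a) ≤ H.card * (I + Real.log 2) := by
  have hN : (1 : ℝ) ≤ H.card := by exact_mod_cast hH.card_pos
  have key : ∀ a, Real.log H.card * P.real (E a) - (I + Real.log 2) ≤
      2⁻¹ * (∫ z, Real.exp (-L a z) ∂P + (H.card - 1) * ∫ z in E a, Real.exp (-L a z) ∂P) - 1 := by
    intro a
    have i1 : Integrable ((E a).indicator fun _ => Real.log H.card) P :=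
      (integrable_const _).indicator (hE a)
    have i2 : Integrable (fun z => L a z + Real.log 2) P := (hL a).add (integrable_const _)
    have i3 : Integrable ((E a).indicator fun z => Real.exp (-L a z)) P :=
      (hexp a).indicator (hE a)
    have i4 : Integrable (fun z => Real.exp (-L a z) +
        (H.card - 1) * (E a).indicator (fun z => Real.exp (-L a z)) z) P :=
      (hexp a).add (i3.const_mul _)
    -- This is `t ≤ exp t - 1` with `t = log N · 1_E - log 2 - L` and `N = |H|`. The factor `exp
    -- (log N · 1_E - log 2)` equals `(1 + (N - 1) 1_E) / 2`.
    have hmono : ∫ z, ((E a).indicator (fun _ => Real.log H.card) z - (L a z + Real.log 2)) ∂P ≤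
        ∫ z, (2⁻¹ * (Real.exp (-L a z) +
          (H.card - 1) * (E a).indicator (fun z => Real.exp (-L a z)) z) - 1) ∂P := by
      refine integral_mono (i1.sub i2) ((i4.const_mul _).sub (integrable_const _)) fun z => ?_
      by_cases hz : z ∈ E a
      · have := Real.add_one_le_exp (Real.log H.card - (L a z + Real.log 2))
        rw [Real.exp_sub, Real.exp_add, Real.exp_log (by linarith), Real.exp_log two_pos] at this
        simp only [Set.indicator_of_mem hz, Real.exp_neg]
        have h2 : (H.card : ℝ) / (Real.exp (L a z) * 2) = 2⁻¹ * ((Real.exp (L a z))⁻¹ +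
            (H.card - 1) * (Real.exp (L a z))⁻¹) := by
          field_simp
          ring
        linarith
      · have := Real.add_one_le_exp (-(L a z + Real.log 2))
        rw [Real.exp_neg, Real.exp_add, Real.exp_log two_pos, mul_inv] at this
        simp only [Set.indicator_of_notMem hz, Real.exp_neg]
        linarith
    rw [integral_sub i1 i2, integral_add (hL a) (integrable_const _), hI,
      integral_sub (i4.const_mul _) (integrable_const _), integral_const_mul,
      integral_add (hexp a) (i3.const_mul _), integral_const_mul, integral_indicator (hE a),
      integral_indicator (hE a)] at hmono
    simpa [mul_comm] using hmono
  have h := Finset.sum_le_sum fun a (_ : a ∈ H) => (key a).trans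
    (sub_le_sub_right (mul_le_mul_of_nonneg_left (add_le_add_left (hexp_le a) _)
      (by norm_num : (0 : ℝ) ≤ 2⁻¹)) 1)
  simp only [Finset.sum_sub_distrib, ← Finset.mul_sum, Finset.sum_add_distrib,
    Finset.sum_const, nsmul_eq_mul, mul_one] at h
  -- Summed over `H`, the right-hand side is at most `(N + (N - 1)) / 2 - N = -1/2`, which is
  -- negative.
  have h5 := mul_le_mul_of_nonneg_left hsum (sub_nonneg.2 hN)
  linarith

end Fano

/-! ### Fano's inequality applied to permutation recovery. -/

section Estimation

variable {n p m : ℕ} {σ : ℝ}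

theorem measurable_observation (B : Matrix (Fin p) (Fin m) ℝ) (π : Equiv.Perm (Fin n)) :
    Measurable fun z : Matrix (Fin n) (Fin p) ℝ × Matrix (Fin n) (Fin m) ℝ =>
      (z.1, observation B π z.1 z.2) :=
  measurable_fst.prodMk (measurable_matrix_add
    (measurable_matrix_mul_const (measurable_const_mul_matrix measurable_fst _) _) measurable_snd)

theorem measurable_logDensityRatio_observation (v : ℝ≥0) (B : Matrix (Fin p) (Fin m) ℝ)
    (R : Matrix (Fin m) (Fin m) ℝ) (π : Equiv.Perm (Fin n)) :
    Measurable fun z : Matrix (Fin n) (Fin p) ℝ × Matrix (Fin n) (Fin m) ℝ =>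
      logDensityRatio v R (π.permMatrix ℝ * z.1 * B) z.2 :=
  measurable_logDensityRatio v R
    (measurable_matrix_mul_const (measurable_const_mul_matrix measurable_fst _) _) measurable_snd

theorem measurable_exp_neg_logDensityRatio_observation (v : ℝ≥0) (B : Matrix (Fin p) (Fin m) ℝ)
    (R : Matrix (Fin m) (Fin m) ℝ) (π : Equiv.Perm (Fin n)) :
    Measurable fun z : Matrix (Fin n) (Fin p) ℝ × Matrix (Fin n) (Fin m) ℝ =>
      Real.exp (-logDensityRatio v R (π.permMatrix ℝ * z.1 * B) z.2) :=
  (measurable_logDensityRatio_observation v B R π).neg.exp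

/-- Conditionally on `X`, the signal is a constant shift, so the change of measure applies
fibrewise. The right-hand side is free of `π`: one reference law serves all permutations. -/
theorem setLIntegral_exp_neg_logDensityRatio (hσ : 0 < σ) (B : Matrix (Fin p) (Fin m) ℝ)
    {R : Matrix (Fin m) (Fin m) ℝ} (hR : R.det ≠ 0) (π : Equiv.Perm (Fin n))
    {A : Set (Matrix (Fin n) (Fin p) ℝ × Matrix (Fin n) (Fin m) ℝ)} (hA : MeasurableSet A) :
    ∫⁻ z in {z | (z.1, observation B π z.1 z.2) ∈ A}, ENNReal.ofReal (Real.exp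
        (-logDensityRatio (Real.toNNReal (σ ^ 2)) R (π.permMatrix ℝ * z.1 * B) z.2))
      ∂(sensingLaw n p m σ) = sensingLaw n p m σ {z | (z.1, z.2 * R) ∈ A} := by
  have hv : Real.toNNReal (σ ^ 2) ≠ 0 := by
    simpa using hσ.ne'
  have hA1 : MeasurableSet {z : Matrix (Fin n) (Fin p) ℝ × Matrix (Fin n) (Fin m) ℝ |
      (z.1, observation B π z.1 z.2) ∈ A} := measurable_observation B π hA
  have hA2 : MeasurableSet {z : Matrix (Fin n) (Fin p) ℝ × Matrix (Fin n) (Fin m) ℝ |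
      (z.1, z.2 * R) ∈ A} :=
    (measurable_fst.prodMk (measurable_matrix_mul_const measurable_snd R)) hA
  have hL := (measurable_exp_neg_logDensityRatio_observation (Real.toNNReal (σ ^ 2)) B R
    π).ennreal_ofReal
  rw [← lintegral_indicator hA1, ← lintegral_indicator_one hA2, sensingLaw,
    lintegral_prod _ (hL.indicator hA1).aemeasurable,
    lintegral_prod _ (measurable_one.indicator hA2).aemeasurable]
  refine lintegral_congr fun X => ?_
  have hX : MeasurableSet {Y | (X, Y) ∈ A} := measurable_prodMk_left hA
  refine Eq.trans ?_ ((lintegral_exp_neg_logDensityRatio hv hR (π.permMatrix ℝ * X * B)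
    (measurable_one.indicator hX)).trans ?_)
  · refine lintegral_congr fun W => ?_
    by_cases h : (X, π.permMatrix ℝ * X * B + W) ∈ A
    · rw [Set.indicator_of_mem (show (X, W) ∈ {z : Matrix (Fin n) (Fin p) ℝ ×
        Matrix (Fin n) (Fin m) ℝ | (z.1, observation B π z.1 z.2) ∈ A} from h),
        Set.indicator_of_mem (show _ ∈ {Y | (X, Y) ∈ A} from h), Pi.one_apply, one_mul]
    · rw [Set.indicator_of_notMem (show (X, W) ∉ {z : Matrix (Fin n) (Fin p) ℝ ×
        Matrix (Fin n) (Fin m) ℝ | (z.1, observation B π z.1 z.2) ∈ A} from h),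
        Set.indicator_of_notMem (show _ ∉ {Y | (X, Y) ∈ A} from h), zero_mul]
  · rfl

theorem integrable_exp_neg_logDensityRatio (hσ : 0 < σ) (B : Matrix (Fin p) (Fin m) ℝ)
    {R : Matrix (Fin m) (Fin m) ℝ} (hR : R.det ≠ 0) (π : Equiv.Perm (Fin n)) :
    Integrable (fun z => Real.exp
      (-logDensityRatio (Real.toNNReal (σ ^ 2)) R (π.permMatrix ℝ * z.1 * B) z.2))
      (sensingLaw n p m σ) := by
  refine ⟨(measurable_exp_neg_logDensityRatio_observation _ B R π).aestronglyMeasurable, ?_⟩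
  rw [hasFiniteIntegral_iff_ofReal (ae_of_all _ fun z => (Real.exp_pos _).le)]
  have h := setLIntegral_exp_neg_logDensityRatio hσ B hR π MeasurableSet.univ
  simp only [Set.mem_univ, Set.ofPred_true, Measure.restrict_univ, measure_univ] at h
  rw [h]
  exact ENNReal.one_lt_top

theorem setIntegral_exp_neg_logDensityRatio (hσ : 0 < σ) (B : Matrix (Fin p) (Fin m) ℝ)
    {R : Matrix (Fin m) (Fin m) ℝ} (hR : R.det ≠ 0) (π : Equiv.Perm (Fin n))
    {A : Set (Matrix (Fin n) (Fin p) ℝ × Matrix (Fin n) (Fin m) ℝ)} (hA : MeasurableSet A) :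
    ∫ z in {z | (z.1, observation B π z.1 z.2) ∈ A}, Real.exp
        (-logDensityRatio (Real.toNNReal (σ ^ 2)) R (π.permMatrix ℝ * z.1 * B) z.2)
      ∂(sensingLaw n p m σ) = (sensingLaw n p m σ).real {z | (z.1, z.2 * R) ∈ A} := by
  rw [integral_eq_lintegral_of_nonneg_ae (ae_of_all _ fun z => (Real.exp_pos _).le)
    (measurable_exp_neg_logDensityRatio_observation _ B R π).aestronglyMeasurable,
    setLIntegral_exp_neg_logDensityRatio hσ B hR π hA]
  rfl

/-- A weak converse: an upper bound for the total probability of exact recovery over `H`. -/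
theorem log_card_mul_sum_success_le (hσ : 0 < σ) (B : Matrix (Fin p) (Fin m) ℝ)
    {H : Finset (Equiv.Perm (Fin n))} (hH : H.Nonempty) (g : Estimator n p m) :
    Real.log H.card * ∑ π ∈ H, (sensingLaw n p m σ).real
        {z | g.toFun z.1 (observation B π z.1 z.2) = π} ≤
      H.card * (n / 2 * Real.log (1 + (σ ^ 2)⁻¹ • (B.transpose * B)).det + Real.log 2) := by
  have hpsd := posSemidef_inv_sq_smul_transpose_mul_self σ B
  obtain ⟨R, hR⟩ := (Matrix.PosSemidef.one.add hpsd).exists_transpose_mul_self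
  have hdet : R.det ≠ 0 := by
    intro h0
    have h1 := hpsd.one_le_det_one_add
    rw [hR, Matrix.det_mul, h0, mul_zero] at h1
    linarith
  have hA : ∀ π, MeasurableSet {z : Matrix (Fin n) (Fin p) ℝ × Matrix (Fin n) (Fin m) ℝ |
    g.toFun z.1 z.2 = π} := g.measurable_toFun
  have hE : ∀ π, MeasurableSet {z : Matrix (Fin n) (Fin p) ℝ × Matrix (Fin n) (Fin m) ℝ |
    g.toFun z.1 (observation B π z.1 z.2) = π} := fun π => measurable_observation B π (hA π)
  refine log_card_mul_sum_measureReal_le hH hE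
    (fun π => (integrable_and_integral_logDensityRatio hσ B hR hdet π).1)
    (fun π => (integrable_and_integral_logDensityRatio hσ B hR hdet π).2)
    (integrable_exp_neg_logDensityRatio hσ B hdet) (fun π => ?_) ?_
  · have h := setIntegral_exp_neg_logDensityRatio hσ B hdet π MeasurableSet.univ
    simp only [Set.mem_univ, Set.ofPred_true, Measure.restrict_univ] at h
    rw [h]
    simp
  · have hsum := Finset.sum_congr (rfl : H = H) fun π _ =>
      setIntegral_exp_neg_logDensityRatio hσ B hdet π (hA π)
    refine hsum.trans_le ?_
    -- Under the common reference law the decision events are disjoint, since the estimator takes a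
    -- single value at each point.
    rw [← measureReal_biUnion_finset]
    · exact measureReal_le_one
    · intro π _ τ _ hne
      refine Set.disjoint_left.2 fun z hz hz' => hne ?_
      exact Eq.trans (Eq.symm hz) hz'
    · exact fun π _ =>
        (measurable_fst.prodMk (measurable_matrix_mul_const measurable_snd R)) (hA π)

end Estimation

/-! ### The minimax lower bound. -/

theorem theorem1 (n p m : ℕ) (σ : ℝ) (hσ : 0 < σ) (B : Matrix (Fin p) (Fin m) ℝ)
    (H : Finset (Equiv.Perm (Fin n))) (b : ℝ) (hb : 2 ≤ b)
    (hlog : Real.logb b (1 + (σ ^ 2)⁻¹ • (B.transpose * B)).det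
      < (Real.logb b (H.card : ℝ) - 2) / n) :
    1 / 2 ≤ minimaxFailureProb σ B H := by
  have hpsd := posSemidef_inv_sq_smul_transpose_mul_self σ B
  have hD : 0 ≤ Real.log (1 + (σ ^ 2)⁻¹ • (B.transpose * B)).det :=
    Real.log_nonneg hpsd.one_le_det_one_add
  -- The base enters only here: two units of base-`b` logarithm cover the `2 log 2` lost in Fano's
  -- inequality.
  have hlogb : Real.log 2 ≤ Real.log b := Real.log_le_log two_pos hb
  have hlog2 : 0 < Real.log 2 := Real.log_pos one_lt_two
  have hb0 : 0 < Real.log b := by linarith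
  -- For `n = 0` the quotient is 0 by convention, and the nonnegative log-determinant cannot lie
  -- below it.
  have hn : (0 : ℝ) < n := by
    refine Nat.cast_pos.2 (Nat.pos_of_ne_zero fun h0 => ?_)
    rw [show (n : ℝ) = 0 from Nat.cast_eq_zero.2 h0, div_zero, Real.logb] at hlog
    exact absurd hlog (not_lt.2 (div_nonneg hD hb0.le))
  have hmain : n * Real.log (1 + (σ ^ 2)⁻¹ • (B.transpose * B)).det <
      Real.log H.card - 2 * Real.log b := by
    rw [lt_div_iff₀ hn, Real.logb, Real.logb, div_mul_eq_mul_div, div_lt_iff₀ hb0, sub_mul,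
      div_mul_cancel₀ _ hb0.ne'] at hlog
    linarith
  have hnD := mul_nonneg hn.le hD
  have hlogN : 0 < Real.log H.card := by linarith
  have hH : H.Nonempty := by
    rw [Finset.nonempty_iff_ne_empty]
    rintro rfl
    simp at hlogN
  refine le_iInf fun g => ?_
  by_contra! hlt
  have hfail : ∀ π ∈ H, 1 / 2 < (sensingLaw n p m σ).real
      {z | g.toFun z.1 (observation B π z.1 z.2) = π} := by
    intro π hπ
    have h1 : failureProb σ B g π < 1 / 2 := (le_iSup₂ (f := fun π (_ : π ∈ H) =>
      failureProb σ B g π) π hπ).trans_lt hlt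
    have h2 : (sensingLaw n p m σ).real {z | g.toFun z.1 (observation B π z.1 z.2) ≠ π} < 1 / 2 := by
      have := (ENNReal.toReal_lt_toReal (measure_ne_top _ _) (by simp)).2 h1
      simpa [measureReal_def, failureProb] using this
    have h3 := probReal_compl_eq_one_sub (μ := sensingLaw n p m σ)
      (measurable_observation B π (g.measurable_toFun π))
    have h4 : (sensingLaw n p m σ).real {z | g.toFun z.1 (observation B π z.1 z.2) ≠ π} =
      1 - (sensingLaw n p m σ).real {z | g.toFun z.1 (observation B π z.1 z.2) = π} := h3
    linarith
  have hsum := Finset.sum_lt_sum_of_nonempty hH hfail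
  rw [Finset.sum_const, nsmul_eq_mul] at hsum
  have hN : (0 : ℝ) < H.card := by exact_mod_cast hH.card_pos
  have h1 := log_card_mul_sum_success_le hσ B hH g
  have h2 := mul_lt_mul_of_pos_left hsum hlogN
  have h3 := mul_lt_mul_of_pos_left hmain hN
  have h4 := mul_le_mul_of_nonneg_left hlogb hN.le
  -- Success above 1/2 on all of `H` gives `log N < n log det + 2 log 2` after division by `N / 2`,
  -- which contradicts `hmain`.
  linarith
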